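/- Consider admission control in an $M/M/c/S$ first-in-first-out queue with $c\ge 1$ servers of rate $\mu>0$, finite capacity $S$, and $m$ job classes with independent Poisson arrivals of rates $\lambda^{(i)}>0$. Admitting a class-$i$ job when $s<S$ jobs are present yields the expected reward $r^{(i)}(s)=R^{(i)}-\mathbb{E}[C_i(W(s))]$, where $R^{(i)}\ge 0$, $C_i\ge 0$ is a holding-cost function, and the waiting time $W(s)$ is $0$ if $s<c$ and Erlang with shape $s-c+1$ and rate $c\mu$ if $s\ge c$. Assume that the expected holding costs $\mathbb{E}[C_i(W(s))]$, $0\le s<S$, are finite and non-decreasing in $s$, and that $r^{(i)}(0)>0$ for at least one class $i$. A (deterministic stationary) policy $\pi$ selects for each state $s\in\{0,\dots,S-1\}$ the set $\pi(s)\subseteq\{1,\dots,m\}$ of admitted classes; nothing is admitted in state $S$. Let $Z^\pi$ be the generator of the resulting birth-and-death process $(s_t)$, with birth rates $\sum_{i\in\pi(s)}\lambda^{(i)}$ and death rates $\min(s,c)\mu$, and let $R^\pi(s)=\sum_{i\in\pi(s)}\lambda^{(i)}r^{(i)}(s)$ for $s<S$, $R^\pi(S)=0$. The average reward of $\pi$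 is $\rho^\pi=\lim_{T\to\infty}\frac1T\mathbb{E}\int_0^T R^\pi(s_t)\,dt$ (for every initial state), and $\pi$ is gain optimal if $\rho^\pi$ is maximal among all policies. The bias $h^\pi$ is the solution $h$ of $\rho^\pi=R^\pi+Z^\pi h$ that has mean zero under the stationary distribution of $\pi$, and $\nabla h^\pi(s)=h^\pi(s)-h^\pi(s+1)$. A policy is bias optimal if it is gain optimal and its bias is, in every state, at least that of every gain optimal policy. A policy is a trunk-reservation policy with control levels $M_1,\dots,M_m\in\{0,\dots,S\}$ if it admits class $i$ in state $s$ exactly when $s<M_i$. Policy Iteration (PI) starts from an arbitrary policy $\pi_0$ and repeats: evaluate $\pi_l$ by solving $\rho=R^{\pi_l}+Z^{\pi_l}h$, which determines $\nabla h^{\pi_l}$; then let $\pi_{l+1}(s)=\{i : r^{(i)}(s)\ge\nabla h^{\pi_l}(s)\}$ for all $0\le s<S$. **Theorem.** There is exactly one bias-optimal policy $\pi^b$. From every initial policy, PI is well defined and converges to $\pi^b$: there is an $L$ with $\pi_l=\pi^b$ for all $l\ge L$. Moreover $\pi^b$ is the trunk-reservation policy with the largest optimal control levels: it is a trunk-reservation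 policy, with control levels $M_i$ say, and every gain optimal trunk-reservation policy has control levels $M'_i\le M_i$ for all $i$. -/

import Mathlib

open MeasureTheory ProbabilityTheory Filter Topology

noncomputable section

/-- Law of the time spent waiting for a free server by a job that finds `s` jobs in the system
(`c` servers of rate `μ`, first in first out): no wait when `s < c`, and otherwise the Erlang
distribution with shape `s - c + 1` and rate `c μ`. -/
def waitLaw (c : ℕ) (μ : ℝ) (s : ℕ) : Measure ℝ :=
  if s < c then Measure.dirac 0 else gammaMeasure ((s : ℝ) - c + 1) (c * μ)

/-- An `M/M/c/S` admission control problem with `m` job classes. -/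
structure AdmissionQueue (m c S : ℕ) where
  /-- arrival rate of each class -/
  arrivalRate : Fin m → ℝ
  /-- service rate of one server -/
  serviceRate : ℝ
  /-- reward collected when a job of the class is admitted -/
  reward : Fin m → ℝ
  /-- holding cost of a job of the class, as a function of its waiting time -/
  cost : Fin m → ℝ → ℝ
  servers_pos : 0 < c
  arrivalRate_pos : ∀ i, 0 < arrivalRate i
  serviceRate_pos : 0 < serviceRate
  reward_nonneg : ∀ i, 0 ≤ reward i
  cost_nonneg : ∀ i t, 0 ≤ t → 0 ≤ cost i t
  /-- the expected holding costs are finite -/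
  cost_integrable : ∀ i s, s < S → Integrable (cost i) (waitLaw c serviceRate s)
  /-- the expected holding costs are non-decreasing in the number of jobs found -/
  cost_mono : ∀ i s, s + 1 < S →
    ∫ w, cost i w ∂(waitLaw c serviceRate s) ≤ ∫ w, cost i w ∂(waitLaw c serviceRate (s + 1))

/-- A deterministic stationary policy: the set of classes admitted in each non-full state
(nothing is admitted in the full state `S`). -/
abbrev AdmissionPolicy (m S : ℕ) := Fin S → Finset (Fin m)

namespace AdmissionQueue

variable {m c S : ℕ} (Q : AdmissionQueue m c S)

/-- Expected reward `r⁽ⁱ⁾(s)` for admitting a job of class `i` that finds `s` jobs. -/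
def netReward (i : Fin m) (s : ℕ) : ℝ :=
  Q.reward i - ∫ w, Q.cost i w ∂(waitLaw c Q.serviceRate s)

/-- Total service rate `μ(s) = min(s, c) μ`. -/
def deathRate (s : ℕ) : ℝ := (min s c : ℕ) * Q.serviceRate

/-- Birth rate `Λ^π(s)`, which is zero in the full state. -/
def birthRate (π : AdmissionPolicy m S) (s : Fin (S + 1)) : ℝ :=
  if h : (s : ℕ) < S then ∑ i ∈ π ⟨s, h⟩, Q.arrivalRate i else 0

/-- Expected reward per unit of time `R^π(s)`, which is zero in the full state. -/
def rewardRate (π : AdmissionPolicy m S) (s : Fin (S + 1)) : ℝ :=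
  if h : (s : ℕ) < S then ∑ i ∈ π ⟨s, h⟩, Q.arrivalRate i * Q.netReward i s else 0

/-- Infinitesimal generator `Z^π` of the birth-and-death process under `π`. -/
def generator (π : AdmissionPolicy m S) : Matrix (Fin (S + 1)) (Fin (S + 1)) ℝ :=
  Matrix.of fun s s' =>
    if (s' : ℕ) = s + 1 then Q.birthRate π s
    else if (s' : ℕ) + 1 = s then Q.deathRate s
    else if s' = s then -(Q.birthRate π s + Q.deathRate s)
    else 0

/-- Expected reward rate `𝔼[R^π(s_t)]` at time `t` of the chain started in `s`, whose transition
semigroup is `exp(t Z^π)`. -/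
def expectedRewardRate (π : AdmissionPolicy m S) (s : Fin (S + 1)) (t : ℝ) : ℝ :=
  Matrix.mulVec (NormedSpace.exp (t • Q.generator π)) (Q.rewardRate π) s

/-- `ρ` is the long-run average reward of `π`, from every initial state. -/
def IsGain (π : AdmissionPolicy m S) (ρ : ℝ) : Prop :=
  ∀ s, Tendsto (fun T : ℝ => (1 / T) * ∫ t in (0 : ℝ)..T, Q.expectedRewardRate π s t)
    atTop (𝓝 ρ)

/-- `π` has maximal long-run average reward. -/
def IsGainOptimal (π : AdmissionPolicy m S) : Prop :=
  ∃ ρ, Q.IsGain π ρ ∧ ∀ π' : AdmissionPolicy m S, ∃ ρ', Q.IsGain π' ρ' ∧ ρ' ≤ ρ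

/-- The evaluation equation `ρ = R^π + Z^π h`. It determines `h` up to an additive constant. -/
def SolvesEvaluation (π : AdmissionPolicy m S) (ρ : ℝ) (h : Fin (S + 1) → ℝ) : Prop :=
  ∀ s, ρ = Q.rewardRate π s + Matrix.mulVec (Q.generator π) h s

/-- `ν` is a stationary distribution of the chain under `π`. -/
def IsStationary (π : AdmissionPolicy m S) (ν : Fin (S + 1) → ℝ) : Prop :=
  (∀ s, 0 ≤ ν s) ∧ ∑ s, ν s = 1 ∧ Matrix.vecMul ν (Q.generator π) = 0

/-- `h` is the bias of `π`: the solution of the evaluation equation, with `ρ` the average reward,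
that has mean zero under the stationary distribution (the standard normalization). -/
def IsBias (π : AdmissionPolicy m S) (h : Fin (S + 1) → ℝ) : Prop :=
  (∃ ρ, Q.IsGain π ρ ∧ Q.SolvesEvaluation π ρ h) ∧
    ∃ ν, Q.IsStationary π ν ∧ ∑ s, ν s * h s = 0

/-- `π` is gain optimal and its bias is maximal, in every state, among gain optimal policies. -/
def IsBiasOptimal (π : AdmissionPolicy m S) : Prop :=
  Q.IsGainOptimal π ∧ ∃ h, Q.IsBias π h ∧
    ∀ π' : AdmissionPolicy m S, Q.IsGainOptimal π' → ∃ h', Q.IsBias π' h' ∧ ∀ s, h' s ≤ h s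

/-- One iteration of policy iteration: evaluate `π`, then admit in each state `s` exactly the
classes with `r⁽ⁱ⁾(s) ≥ ∇h^π(s) = h^π(s) - h^π(s+1)`. -/
def IsPIStep (π π' : AdmissionPolicy m S) : Prop :=
  ∃ ρ h, Q.SolvesEvaluation π ρ h ∧
    ∀ (s : Fin S) (i : Fin m), i ∈ π' s ↔ h s.castSucc - h s.succ ≤ Q.netReward i s

/-- `π` is a sequence of policies produced by policy iteration. -/
def IsPIRun (π : ℕ → AdmissionPolicy m S) : Prop :=
  ∀ l, Q.IsPIStep (π l) (π (l + 1))

end AdmissionQueue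

/-- `π` is the trunk reservation policy with control levels `M`: class `i` is admitted if and only
if there are fewer than `M i` jobs in the system. As nothing is admitted in state `S`, the levels
are taken at most `S`, so that they are determined by the policy. -/
def IsTrunkReservation {m S : ℕ} (π : AdmissionPolicy m S) (M : Fin m → ℕ) : Prop :=
  (∀ i, M i ≤ S) ∧ ∀ (s : Fin S) (i : Fin m), i ∈ π s ↔ (s : ℕ) < M i

end

/-! Write `d` for the decrements of a relative value function. On a birth-and-death chain the
evaluation equation is a first-order recursion in `d`, so policies can be compared state by state.
If one policy is at least as good as another against the latter's `d`, its gain is at least as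
large, and with equal gains its decrements are no larger (`BirthDeathPoisson.comparison`). Hence
along policy iteration the gain increases, and then the decrements decrease; as there are finitely
many policies, the decrements stabilize and the run reaches a policy that is greedy for its own `d`.
Two such fixed policies dominate each other, so they have the same `d` and coincide. The fixed
policy `πb` is gain optimal.

The decrements of `πb` satisfy the optimality equation. They are positive and non-decreasing:
forward induction works while death rates grow and rewards are constant, backward induction once
death rates are constant. As rewards decrease with the state, `πb` is a trunk-reservation policy.

Ties are admitted, so in the states it reaches a gain optimal policy `π` admits a subset of what
`πb` admits. The stationary law of `πb` therefore dominates that of `π` in likelihood ratio. Since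
`h` is strictly decreasing with mean zero under `πb`, its mean under `π` is nonnegative
(`chebyshev_likelihood_ratio`). The bias `h'` of `π` differs from `h` by a constant on the states
reached by `π`, and by no more than that constant elsewhere; the normalization makes this constant
minus that mean, so `h' ≤ h`. The equality case of Chebyshev gives uniqueness, and the inclusion in
reached states bounds the control levels. -/

/-- The Poisson equation of a birth-and-death chain on `{0, …, S}` with birth rates `Λ`, death
rates `μ` and reward rates `f`, written in terms of the gain `ρ` and of the decrements `d` of the
relative value function. -/
structure BirthDeathPoisson (S : ℕ) (Λ μ f : ℕ → ℝ) (ρ : ℝ) (d : ℕ → ℝ) : Prop where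
  zero : ρ = f 0 - Λ 0 * d 0
  succ : ∀ s < S, ρ = f (s + 1) - Λ (s + 1) * d (s + 1) + μ (s + 1) * d s

/-! ### Comparison of birth-and-death chains -/

namespace BirthDeathPoisson

variable {S : ℕ} {Λ Λ' μ f f' : ℕ → ℝ} {ρ ρ' : ℝ} {d d' : ℕ → ℝ}

theorem neg (H : BirthDeathPoisson S Λ μ f ρ d) :
    BirthDeathPoisson S Λ μ (fun s => -f s) (-ρ) (fun s => -d s) :=
  ⟨by rw [H.zero]; ring, fun s hs => by rw [H.succ s hs]; ring⟩

/-- If the second chain does at least as well as the first one against the value function of the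
first, then its gain is at least as large. -/
theorem comparison (H : BirthDeathPoisson S Λ μ f ρ d) (H' : BirthDeathPoisson S Λ' μ f' ρ' d')
    (hμ : ∀ s < S, 0 < μ (s + 1)) (hΛ : ∀ s, 0 ≤ Λ' s) (hS : Λ' S = 0)
    (hg : ∀ s ≤ S, f s - Λ s * d s ≤ f' s - Λ' s * d s) :
    ρ ≤ ρ' ∧ (ρ' = ρ → ∀ s < S, d' s ≤ d s) := by
  -- Backward induction from the full state, where the birth term vanishes: a bound on `d' - d` at
  -- `s + 1` passes to `s` through the death term. The equation at `0` then excludes `ρ' < ρ`.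
  have key : ρ' ≤ ρ → ∀ s < S, μ (s + 1) * (d' s - d s) ≤ 0 ∧ d' s ≤ d s := by
    intro hρ
    have hstep : ∀ s < S, Λ' (s + 1) * (d' (s + 1) - d (s + 1)) ≤ 0 →
        μ (s + 1) * (d' s - d s) ≤ 0 ∧ d' s ≤ d s := by
      intro s hs h
      have h1 := H.succ s hs
      have h2 := H'.succ s hs
      have h3 := hg (s + 1) hs
      have h4 : μ (s + 1) * (d' s - d s) ≤ 0 := by linarith
      refine ⟨h4, ?_⟩
      by_contra! hc
      have := mul_pos (hμ s hs) (sub_pos.2 hc)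
      linarith
    have hall : ∀ k s, s + k = S → Λ' s * (d' s - d s) ≤ 0 := by
      intro k
      induction k with
      | zero => intro s hs; simp only [add_zero] at hs; subst hs; simp [hS]
      | succ k ih =>
        intro s hs
        have h := (hstep s (by omega) (ih (s + 1) (by omega))).2
        exact mul_nonpos_of_nonneg_of_nonpos (hΛ s) (sub_nonpos.2 h)
    exact fun s hs => hstep s hs (hall (S - (s + 1)) (s + 1) (by omega))
  refine ⟨?_, fun h s hs => (key h.le s hs).2⟩
  by_contra! hc
  have h0 := hg 0 (Nat.zero_le _)
  have h1 := H.zero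
  have h2 := H'.zero
  have h3 : Λ' 0 * (d' 0 - d 0) ≤ 0 := by
    rcases Nat.eq_zero_or_pos S with h | h
    · subst h; simp [hS]
    · exact mul_nonpos_of_nonneg_of_nonpos (hΛ 0) (sub_nonpos.2 (key hc.le 0 h).2)
  linarith

/-- The version of `comparison` in which the second chain does at most as well. -/
theorem comparison_le (H : BirthDeathPoisson S Λ μ f ρ d)
    (H' : BirthDeathPoisson S Λ' μ f' ρ' d')
    (hμ : ∀ s < S, 0 < μ (s + 1)) (hΛ : ∀ s, 0 ≤ Λ' s) (hS : Λ' S = 0)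
    (hg : ∀ s ≤ S, f' s - Λ' s * d s ≤ f s - Λ s * d s) :
    ρ' ≤ ρ ∧ (ρ' = ρ → ∀ s < S, d s ≤ d' s) := by
  have h := H.neg.comparison H'.neg hμ hΛ hS (fun s hs => by linarith [hg s hs])
  exact ⟨neg_le_neg_iff.1 h.1, fun e s hs => neg_le_neg_iff.1 (h.2 (by rw [e]) s hs)⟩

theorem unique (H : BirthDeathPoisson S Λ μ f ρ d) (H' : BirthDeathPoisson S Λ μ f ρ' d')
    (hμ : ∀ s < S, 0 < μ (s + 1)) (hΛ : ∀ s, 0 ≤ Λ s) (hS : Λ S = 0) :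
    ρ' = ρ ∧ ∀ s < S, d' s = d s := by
  have h1 := H.comparison H' hμ hΛ hS (fun _ _ => le_rfl)
  have h2 := H'.comparison H hμ hΛ hS (fun _ _ => le_rfl)
  have e : ρ' = ρ := le_antisymm h2.1 h1.1
  exact ⟨e, fun s hs => le_antisymm (h1.2 e s hs) (h2.2 e.symm s hs)⟩

/-- A chain that does at most as well as the first one against its value function, with the same
gain, does exactly as well in every state it reaches from `0`. -/
theorem eq_of_reachable (H : BirthDeathPoisson S Λ μ f ρ d)
    (H' : BirthDeathPoisson S Λ' μ f' ρ d')
    (hμ : ∀ s < S, 0 < μ (s + 1)) (hΛ : ∀ s, 0 ≤ Λ' s) (hS : Λ' S = 0)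
    (hg : ∀ s ≤ S, f' s - Λ' s * d s ≤ f s - Λ s * d s) :
    ∀ s ≤ S, (∀ j < s, 0 < Λ' j) →
      f' s - Λ' s * d s = f s - Λ s * d s ∧ ∀ j < s, d' j = d j := by
  have hd := (H.comparison_le H' hμ hΛ hS hg).2 rfl
  have hn : ∀ s ≤ S, 0 ≤ Λ' s * (d' s - d s) := by
    intro s hs
    rcases hs.eq_or_lt with h | h
    · simp [h, hS]
    · exact mul_nonneg (hΛ s) (sub_nonneg.2 (hd s h))
  -- Forward induction. The slack in state `s` and the term `Λ' s * (d' s - d s)` are both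
  -- nonnegative and sum to zero; a positive birth rate then forces `d' s = d s` and carries the
  -- equality to `s + 1`.
  have main : ∀ s ≤ S, (∀ j < s, 0 < Λ' j) →
      f' s - Λ' s * d s = f s - Λ s * d s ∧ Λ' s * (d' s - d s) = 0 ∧ ∀ j < s, d' j = d j := by
    intro s
    induction s with
    | zero =>
      intro _ _
      have h0 := hg 0 (Nat.zero_le _)
      have h1 := H.zero
      have h2 := H'.zero
      have h3 := hn 0 (Nat.zero_le _)
      exact ⟨by linarith, by linarith, by simp⟩
    | succ s ih =>
      intro hs hr
      obtain ⟨-, hz, hj⟩ := ih (by omega) (fun j hj => hr j (by omega))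
      have hds : d' s = d s := by
        rcases mul_eq_zero.1 hz with h | h
        · exact absurd h (hr s (by omega)).ne'
        · linarith
      have h0 := hg (s + 1) hs
      have h1 := H.succ s hs
      have h2 := H'.succ s hs
      have h3 := hn (s + 1) hs
      rw [hds] at h2
      refine ⟨by linarith, by linarith, fun j hj' => ?_⟩
      rcases (Nat.lt_succ_iff.1 hj').eq_or_lt with h | h
      · rw [h, hds]
      · exact hj j h
  exact fun s hs hr => ⟨(main s hs hr).1, (main s hs hr).2.2⟩

end BirthDeathPoisson

/-! ### The evaluation equation as a recursion on decrements -/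

namespace AdmissionQueue

variable {m c S : ℕ} (Q : AdmissionQueue m c S)

/-- Extension by zero of a function of the state to all natural numbers. -/
noncomputable def natExt (f : Fin (S + 1) → ℝ) (n : ℕ) : ℝ := if h : n < S + 1 then f ⟨n, h⟩ else 0

/-- The decrements `∇h(s) = h(s) - h(s + 1)` of a function of the state. -/
noncomputable def drop (h : Fin (S + 1) → ℝ) (n : ℕ) : ℝ :=
  if hn : n < S then h ⟨n, by omega⟩ - h ⟨n + 1, by omega⟩ else 0

theorem natExt_coe (f : Fin (S + 1) → ℝ) (s : Fin (S + 1)) : natExt f s = f s :=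
  dif_pos s.2

theorem natExt_of_le (f : Fin (S + 1) → ℝ) {s : ℕ} (hs : s ≤ S) :
    natExt f s = f ⟨s, Nat.lt_succ_of_le hs⟩ := by
  simp [natExt, Nat.lt_succ_of_le hs]

theorem drop_coe (h : Fin (S + 1) → ℝ) (s : Fin S) : drop h s = h s.castSucc - h s.succ := by
  simp [drop, s.2]; rfl

theorem natExt_succ (h : Fin (S + 1) → ℝ) {s : ℕ} (hs : s < S) :
    natExt h (s + 1) = natExt h s - drop h s := by
  simp [natExt, drop, hs, Nat.lt_succ_of_lt hs]

theorem drop_add_const (h : Fin (S + 1) → ℝ) (a : ℝ) :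
    drop (fun s => h s + a) = drop h := by
  ext n; simp [drop]

theorem deathRate_zero : Q.deathRate 0 = 0 := by simp [deathRate]

theorem deathRate_pos (s : ℕ) : 0 < Q.deathRate (s + 1) := by
  have : 0 < min (s + 1) c := lt_min (Nat.succ_pos _) Q.servers_pos
  exact mul_pos (by exact_mod_cast this) Q.serviceRate_pos

theorem deathRate_nonneg (s : ℕ) : 0 ≤ Q.deathRate s :=
  mul_nonneg (by positivity) Q.serviceRate_pos.le

theorem deathRate_mono {s t : ℕ} (h : s ≤ t) : Q.deathRate s ≤ Q.deathRate t := by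
  have : min s c ≤ min t c := min_le_min_right _ h
  exact mul_le_mul_of_nonneg_right (by exact_mod_cast this) Q.serviceRate_pos.le

theorem birthRate_nonneg (π : AdmissionPolicy m S) (s : Fin (S + 1)) : 0 ≤ Q.birthRate π s := by
  unfold birthRate
  split_ifs
  · exact Finset.sum_nonneg fun i _ => (Q.arrivalRate_pos i).le
  · exact le_rfl

theorem natExt_birthRate_nonneg (π : AdmissionPolicy m S) (s : ℕ) :
    0 ≤ natExt (Q.birthRate π) s := by
  unfold natExt
  split_ifs
  · exact Q.birthRate_nonneg π _
  · exact le_rfl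

theorem natExt_birthRate_last (π : AdmissionPolicy m S) : natExt (Q.birthRate π) S = 0 := by
  simp [natExt, birthRate]

theorem natExt_birthRate (π : AdmissionPolicy m S) {s : ℕ} (hs : s < S) :
    natExt (Q.birthRate π) s = ∑ i ∈ π ⟨s, hs⟩, Q.arrivalRate i := by
  simp [natExt, birthRate, hs, Nat.lt_succ_of_lt hs]

/-- The reward rate of a policy net of the cost `x` of one more job. -/
theorem rewardRate_sub_birthRate_mul (π : AdmissionPolicy m S) {s : ℕ} (hs : s < S) (x : ℝ) :
    natExt (Q.rewardRate π) s - natExt (Q.birthRate π) s * x =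
      ∑ i ∈ π ⟨s, hs⟩, Q.arrivalRate i * (Q.netReward i s - x) := by
  simp [natExt, birthRate, rewardRate, hs, Nat.lt_succ_of_lt hs, mul_sub, Finset.sum_sub_distrib,
    Finset.sum_mul]

theorem rewardRate_sub_birthRate_mul_last (π : AdmissionPolicy m S) (x : ℝ) :
    natExt (Q.rewardRate π) S - natExt (Q.birthRate π) S * x = 0 := by
  simp [natExt, birthRate, rewardRate]

theorem generator_apply (π : AdmissionPolicy m S) (s s' : Fin (S + 1)) :
    Q.generator π s s' = (if (s' : ℕ) = s + 1 then Q.birthRate π s else 0) +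
      (if (s' : ℕ) + 1 = s then Q.deathRate s else 0) -
      (if s' = s then Q.birthRate π s + Q.deathRate s else 0) := by
  simp only [generator, Matrix.of_apply, Fin.ext_iff]
  split_ifs <;> first | omega | ring

/-- The truncated `s - 1` at `s = 0` and the default value of `drop` at `S` are harmless: they are
multiplied by a zero death rate and a zero birth rate. -/
theorem generator_mulVec (π : AdmissionPolicy m S) (h : Fin (S + 1) → ℝ) (s : Fin (S + 1)) :
    Matrix.mulVec (Q.generator π) h s =
      -(Q.birthRate π s * drop h s) + Q.deathRate s * drop h ((s : ℕ) - 1) := by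
  have h1 : ∑ x : Fin (S + 1), (if (x : ℕ) = s + 1 then Q.birthRate π s else 0) * h x =
      Q.birthRate π s * (h s - drop h s) := by
    by_cases hs : (s : ℕ) < S
    · rw [Finset.sum_eq_single ⟨s + 1, by omega⟩]
      · simp [drop, hs]
      · intro b _ hb
        rw [if_neg, zero_mul]
        exact fun e => hb (Fin.ext e)
      · simp
    · simp [birthRate, hs]
  have h2 : ∑ x : Fin (S + 1), (if (x : ℕ) + 1 = s then Q.deathRate s else 0) * h x =
      Q.deathRate s * (h s + drop h ((s : ℕ) - 1)) := by
    rcases Nat.eq_zero_or_pos (s : ℕ) with hs | hs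
    · simp [hs, deathRate_zero]
    · rw [Finset.sum_eq_single ⟨s - 1, by omega⟩]
      · have e : (s : ℕ) - 1 < S := by omega
        have e' : (s : ℕ) - 1 + 1 = s := by omega
        simp [drop, e, e']
      · intro b _ hb
        rw [if_neg, zero_mul]
        exact fun e => hb (Fin.ext (by simp; omega))
      · simp
  simp only [Matrix.mulVec, dotProduct, generator_apply, sub_mul, add_mul,
    Finset.sum_sub_distrib, Finset.sum_add_distrib, h1, h2]
  simp
  ring

/-- The evaluation equation with an arbitrary reward vector is a birth-and-death Poisson
equation. -/
theorem poisson_iff (π : AdmissionPolicy m S) (f h : Fin (S + 1) → ℝ) (ρ : ℝ) :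
    (∀ s, ρ = f s + Matrix.mulVec (Q.generator π) h s) ↔
      BirthDeathPoisson S (natExt (Q.birthRate π)) Q.deathRate (natExt f) ρ (drop h) := by
  constructor
  · intro H
    constructor
    · have := H 0
      rw [generator_mulVec] at this
      rw [natExt_of_le _ (Nat.zero_le _), natExt_of_le _ (Nat.zero_le _)]
      simp only [Fin.val_zero, deathRate_zero, zero_mul, add_zero] at this
      rw [sub_eq_add_neg]; exact this
    · intro s hs
      have := H ⟨s + 1, by omega⟩
      rw [generator_mulVec] at this
      rw [natExt_of_le _ hs, natExt_of_le _ hs]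
      simp only [Nat.add_sub_cancel] at this
      rw [sub_eq_add_neg, add_assoc]; exact this
  · rintro ⟨h0, h1⟩ ⟨s, hs⟩
    rw [generator_mulVec]
    cases s with
    | zero =>
      rw [natExt_of_le _ (Nat.zero_le _), natExt_of_le _ (Nat.zero_le _)] at h0
      simp only [deathRate_zero, zero_mul, add_zero]
      rw [sub_eq_add_neg] at h0; exact h0
    | succ s =>
      have := h1 s (by omega)
      rw [natExt_of_le _ (by omega), natExt_of_le _ (by omega)] at this
      simp only [Nat.add_sub_cancel]
      rw [sub_eq_add_neg, add_assoc] at this; exact this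

theorem poisson_unique {π : AdmissionPolicy m S} {f : ℕ → ℝ} {ρ ρ' : ℝ} {d d' : ℕ → ℝ}
    (H : BirthDeathPoisson S (natExt (Q.birthRate π)) Q.deathRate f ρ d)
    (H' : BirthDeathPoisson S (natExt (Q.birthRate π)) Q.deathRate f ρ' d') :
    ρ' = ρ ∧ ∀ s < S, d' s = d s :=
  H.unique H' (fun s _ => Q.deathRate_pos s) (Q.natExt_birthRate_nonneg π)
    (Q.natExt_birthRate_last π)

theorem eq_const_of_drop_eq_zero {h : Fin (S + 1) → ℝ} (hd : ∀ s < S, drop h s = 0)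
    (s : Fin (S + 1)) : h s = h 0 := by
  have : ∀ n ≤ S, natExt h n = natExt h 0 := by
    intro n
    induction n with
    | zero => simp
    | succ n ih =>
      intro hn
      rw [natExt_succ h (by omega), hd n (by omega), ih (by omega), sub_zero]
  have := this s (by omega)
  rwa [natExt_coe, natExt_of_le _ (Nat.zero_le _)] at this

/-- The evaluation equation is solvable for every policy and every reward vector. -/
theorem exists_poisson (π : AdmissionPolicy m S) (f : Fin (S + 1) → ℝ) :
    ∃ ρ h, ∀ s, ρ = f s + Matrix.mulVec (Q.generator π) h s := by
  -- Normalizing by `ρ = -h 0` turns the equation into a square linear system. Uniqueness of gain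
  -- and decrements makes it injective, hence surjective.
  let L : (Fin (S + 1) → ℝ) →ₗ[ℝ] (Fin (S + 1) → ℝ) :=
    Matrix.mulVecLin (Q.generator π) + LinearMap.pi fun _ => LinearMap.proj 0
  have hL : ∀ h s, L h s = Matrix.mulVec (Q.generator π) h s + h 0 := fun h s => by simp [L]
  have hinj : Function.Injective L := by
    rw [← LinearMap.ker_eq_bot, LinearMap.ker_eq_bot']
    intro h hh
    have H : ∀ s, -h 0 = (0 : Fin (S + 1) → ℝ) s + Matrix.mulVec (Q.generator π) h s := by
      intro s
      have := congrFun hh s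
      rw [hL] at this
      simp only [Pi.zero_apply] at this ⊢
      linarith
    have H0 : ∀ s, (0 : ℝ) = (0 : Fin (S + 1) → ℝ) s + Matrix.mulVec (Q.generator π) 0 s := by
      simp
    rw [poisson_iff] at H H0
    obtain ⟨e, hd⟩ := Q.poisson_unique H0 H
    have hc := eq_const_of_drop_eq_zero (h := h) (fun s hs => by
      rw [hd s hs]; simp [drop])
    ext s
    rw [hc s]
    simpa using e
  obtain ⟨h, hh⟩ := LinearMap.injective_iff_surjective.1 hinj (fun s => -f s)
  refine ⟨-h 0, h, fun s => ?_⟩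
  have := congrFun hh s
  rw [hL] at this
  linarith

end AdmissionQueue

/-! ### Boundedness of the transition semigroup -/

/-- `‖exp x‖ ≤ exp ‖x‖` in a real Banach algebra. -/
theorem norm_exp_le_exp_norm {A : Type*} [NormedRing A] [NormOneClass A] [NormedAlgebra ℝ A]
    [CompleteSpace A] (x : A) : ‖NormedSpace.exp x‖ ≤ Real.exp ‖x‖ := by
  have h1 := NormedSpace.exp_series_hasSum_exp' (𝕂 := ℝ) x
  have h2 := NormedSpace.exp_series_hasSum_exp' (𝕂 := ℝ) ‖x‖
  rw [← Real.exp_eq_exp_ℝ] at h2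
  rw [← h1.tsum_eq]
  refine tsum_of_norm_bounded h2 fun n => ?_
  rw [norm_smul, smul_eq_mul, Real.norm_of_nonneg (by positivity)]
  gcongr
  exact norm_pow_le x n

/-- A uniformization bound: `‖exp (t z)‖ ≤ 1` as soon as `‖z + q‖ ≤ q`. -/
theorem norm_exp_smul_le_one {A : Type*} [NormedRing A] [NormOneClass A] [NormedAlgebra ℝ A]
    [CompleteSpace A] {z : A} {q : ℝ} (hz : ‖z + q • (1 : A)‖ ≤ q) {t : ℝ} (ht : 0 ≤ t) :
    ‖NormedSpace.exp (t • z)‖ ≤ 1 := by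
  let _ : NormedAlgebra ℚ A := NormedAlgebra.restrictScalars ℚ ℝ A
  have e : t • z = (-(t * q)) • (1 : A) + t • (z + q • (1 : A)) := by
    rw [smul_add, smul_smul, neg_smul]; abel
  have hc : Commute ((-(t * q)) • (1 : A)) (t • (z + q • (1 : A))) :=
    (Commute.one_left _).smul_left _
  rw [e, NormedSpace.exp_add_of_commute hc]
  have h1 : NormedSpace.exp ((-(t * q)) • (1 : A)) = Real.exp (-(t * q)) • (1 : A) := by
    rw [← Algebra.algebraMap_eq_smul_one, ← Algebra.algebraMap_eq_smul_one,
      Real.exp_eq_exp_ℝ, NormedSpace.algebraMap_exp_comm]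
  rw [h1, smul_mul_assoc, one_mul, norm_smul, Real.norm_of_nonneg (Real.exp_pos _).le]
  calc _ ≤ Real.exp (-(t * q)) * Real.exp (t * q) := by
        gcongr
        refine (norm_exp_le_exp_norm _).trans (Real.exp_le_exp.2 ?_)
        rw [norm_smul, Real.norm_of_nonneg ht]
        gcongr
    _ = 1 := by rw [← Real.exp_add]; simp

open scoped Matrix.Norms.Operator in
theorem hasDerivAt_exp_smul_mulVec {ι : Type*} [Fintype ι] [DecidableEq ι] (Z : Matrix ι ι ℝ)
    (v : ι → ℝ) (i : ι) (t : ℝ) :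
    HasDerivAt (fun t : ℝ => Matrix.mulVec (NormedSpace.exp (t • Z)) v i)
      (Matrix.mulVec (NormedSpace.exp (t • Z)) (Matrix.mulVec Z v) i) t := by
  have h := hasDerivAt_exp_smul_const (𝕂 := ℝ) Z t
  let φ : Matrix ι ι ℝ →ₗ[ℝ] ℝ :=
    { toFun := fun A => Matrix.mulVec A v i
      map_add' := fun A B => by simp [Matrix.add_mulVec]
      map_smul' := fun a A => by simp [Matrix.smul_mulVec] }
  have h2 := (LinearMap.toContinuousLinearMap φ).hasFDerivAt.comp_hasDerivAt t h
  rw [Matrix.mulVec_mulVec]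
  exact h2

open scoped Matrix.Norms.Operator in
/-- The semigroup of a generator is bounded. -/
theorem abs_exp_smul_mulVec_le {ι : Type*} [Fintype ι] [DecidableEq ι] [Nonempty ι]
    {Z : Matrix ι ι ℝ} (hoff : ∀ i j, i ≠ j → 0 ≤ Z i j) (hrow : ∀ i, ∑ j, Z i j = 0)
    (v : ι → ℝ) (i : ι) {t : ℝ} (ht : 0 ≤ t) :
    |Matrix.mulVec (NormedSpace.exp (t • Z)) v i| ≤ ‖v‖ := by
  have hq0 : ∀ i, 0 ≤ -Z i i := by
    intro i
    have := hrow i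
    rw [← Finset.add_sum_erase _ _ (Finset.mem_univ i)] at this
    have h2 : 0 ≤ ∑ j ∈ Finset.univ.erase i, Z i j :=
      Finset.sum_nonneg fun j hj => hoff i j (Finset.ne_of_mem_erase hj).symm
    linarith
  -- The sum of all exit rates is a crude uniformization rate: `Z + q` has nonnegative entries and
  -- all its row sums equal `q`, so its operator norm is at most `q`.
  set q := ∑ i, -Z i i with hq
  have hqi : ∀ i, 0 ≤ Z i i + q := by
    intro i
    have := Finset.single_le_sum (fun j _ => hq0 j) (Finset.mem_univ i)
    linarith
  have hZ : ‖Z + q • (1 : Matrix ι ι ℝ)‖ ≤ q := by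
    have hqn : 0 ≤ q := Finset.sum_nonneg fun j _ => hq0 j
    rw [Matrix.linfty_opNorm_def]
    rw [← Real.coe_toNNReal q hqn, NNReal.coe_le_coe]
    refine Finset.sup_le fun i _ => ?_
    rw [← NNReal.coe_le_coe, Real.coe_toNNReal q hqn, NNReal.coe_sum]
    apply le_of_eq
    have : ∀ j, ((‖(Z + q • (1 : Matrix ι ι ℝ)) i j‖₊ : NNReal) : ℝ) =
        Z i j + q * (1 : Matrix ι ι ℝ) i j := by
      intro j
      rw [coe_nnnorm, Matrix.add_apply, Matrix.smul_apply, smul_eq_mul, Real.norm_of_nonneg]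
      by_cases hij : i = j
      · subst hij; simpa using hqi i
      · simpa [hij] using hoff i j hij
    simp only [this, Finset.sum_add_distrib, ← Finset.mul_sum, hrow, zero_add]
    simp [Matrix.one_apply]
  have h1 : ‖NormedSpace.exp (t • Z)‖ ≤ 1 := norm_exp_smul_le_one hZ ht
  calc |Matrix.mulVec (NormedSpace.exp (t • Z)) v i|
      ≤ ‖Matrix.mulVec (NormedSpace.exp (t • Z)) v‖ :=
        norm_le_pi_norm (Matrix.mulVec (NormedSpace.exp (t • Z)) v) i
    _ ≤ ‖NormedSpace.exp (t • Z)‖ * ‖v‖ := Matrix.linfty_opNorm_mulVec _ _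
    _ ≤ ‖v‖ := mul_le_of_le_one_left (norm_nonneg _) h1

/-! ### The gain is the constant in the evaluation equation -/

namespace AdmissionQueue

variable {m c S : ℕ} (Q : AdmissionQueue m c S)

theorem generator_nonneg (π : AdmissionPolicy m S) (s s' : Fin (S + 1)) (h : s ≠ s') :
    0 ≤ Q.generator π s s' := by
  have h1 := Q.birthRate_nonneg π s
  have h2 := Q.deathRate_nonneg s
  rw [generator_apply, if_neg (Ne.symm h)]
  split_ifs <;> linarith

theorem generator_mulVec_const (π : AdmissionPolicy m S) (a : ℝ) :
    Matrix.mulVec (Q.generator π) (fun _ => a) = 0 := by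
  ext s
  rw [generator_mulVec]
  simp [drop]

theorem sum_generator (π : AdmissionPolicy m S) (s : Fin (S + 1)) :
    ∑ s', Q.generator π s s' = 0 := by
  have := congrFun (Q.generator_mulVec_const π 1) s
  simpa [Matrix.mulVec, dotProduct] using this

theorem exp_generator_mulVec_const (π : AdmissionPolicy m S) (a t : ℝ) (s : Fin (S + 1)) :
    Matrix.mulVec (NormedSpace.exp (t • Q.generator π)) (fun _ => a) s = a := by
  have hd : ∀ t : ℝ, HasDerivAt
      (fun t : ℝ => Matrix.mulVec (NormedSpace.exp (t • Q.generator π)) (fun _ => a) s) 0 t := by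
    intro t
    have := hasDerivAt_exp_smul_mulVec (Q.generator π) (fun _ => a) s t
    rwa [generator_mulVec_const, Matrix.mulVec_zero] at this
  have h := is_const_of_deriv_eq_zero (fun t => (hd t).differentiableAt)
    (fun t => (hd t).deriv) t 0
  simpa using h

/-- Since `Z h = ρ - R`, the function `ρ t - exp(t Z) h` is a primitive of the expected reward rate.
The semigroup is bounded, so dividing by `T` leaves only `ρ`. -/
theorem SolvesEvaluation.isGain {π : AdmissionPolicy m S} {ρ : ℝ} {h : Fin (S + 1) → ℝ}
    (H : Q.SolvesEvaluation π ρ h) : Q.IsGain π ρ := by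
  intro s
  have hZ : Matrix.mulVec (Q.generator π) h = (fun _ => ρ) - Q.rewardRate π := by
    ext s
    have := H s
    simp only [Pi.sub_apply]
    linarith
  have hd : ∀ t : ℝ, HasDerivAt
      (fun t : ℝ => ρ * t - Matrix.mulVec (NormedSpace.exp (t • Q.generator π)) h s)
      (Q.expectedRewardRate π s t) t := by
    intro t
    have h1 := ((hasDerivAt_id t).const_mul ρ).sub
      (hasDerivAt_exp_smul_mulVec (Q.generator π) h s t)
    refine h1.congr_deriv ?_
    rw [hZ, Matrix.mulVec_sub, Pi.sub_apply, exp_generator_mulVec_const]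
    simp [expectedRewardRate]
  have hcont : Continuous (Q.expectedRewardRate π s) :=
    continuous_iff_continuousAt.2 fun t =>
      (hasDerivAt_exp_smul_mulVec (Q.generator π) (Q.rewardRate π) s t).continuousAt
  have hint : ∀ T : ℝ, ∫ t in (0 : ℝ)..T, Q.expectedRewardRate π s t =
      ρ * T - Matrix.mulVec (NormedSpace.exp (T • Q.generator π)) h s + h s := by
    intro T
    rw [intervalIntegral.integral_eq_sub_of_hasDerivAt (fun t _ => hd t)
      (hcont.intervalIntegrable _ _)]
    simp
  have hlim : Tendsto (fun T : ℝ => (1 / T) *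
      (h s - Matrix.mulVec (NormedSpace.exp (T • Q.generator π)) h s)) atTop (𝓝 0) := by
    have h0 : Tendsto (fun T : ℝ => (1 / T) * (|h s| + ‖h‖)) atTop (𝓝 0) := by
      simpa using (tendsto_inv_atTop_zero (𝕜 := ℝ)).mul_const (|h s| + ‖h‖)
    refine squeeze_zero_norm' ?_ h0
    filter_upwards [eventually_gt_atTop 0] with T hT
    rw [norm_mul, Real.norm_of_nonneg (by positivity)]
    gcongr
    refine (norm_sub_le _ _).trans (add_le_add le_rfl ?_)
    exact abs_exp_smul_mulVec_le (Q.generator_nonneg π) (Q.sum_generator π) h s hT.le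
  have h2 := hlim.const_add ρ
  rw [add_zero] at h2
  refine h2.congr' ?_
  filter_upwards [eventually_gt_atTop 0] with T hT
  rw [hint]
  field_simp
  ring

theorem IsGain.eq {π : AdmissionPolicy m S} {ρ ρ' : ℝ} (H : Q.IsGain π ρ) (H' : Q.IsGain π ρ') :
    ρ = ρ' :=
  tendsto_nhds_unique (H 0) (H' 0)

theorem exists_solvesEvaluation (π : AdmissionPolicy m S) :
    ∃ ρ h, Q.SolvesEvaluation π ρ h :=
  Q.exists_poisson π _

theorem SolvesEvaluation.poisson {π : AdmissionPolicy m S} {ρ : ℝ} {h : Fin (S + 1) → ℝ}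
    (H : Q.SolvesEvaluation π ρ h) :
    BirthDeathPoisson S (natExt (Q.birthRate π)) Q.deathRate (natExt (Q.rewardRate π)) ρ
      (drop h) :=
  (Q.poisson_iff π _ _ _).1 H

theorem SolvesEvaluation.add_const {π : AdmissionPolicy m S} {ρ : ℝ} {h : Fin (S + 1) → ℝ}
    (H : Q.SolvesEvaluation π ρ h) (a : ℝ) : Q.SolvesEvaluation π ρ (fun s => h s + a) := by
  refine (Q.poisson_iff π _ _ _).2 ?_
  rw [drop_add_const]
  exact H.poisson

end AdmissionQueue

/-! ### Finite maximization and a Chebyshev inequality -/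

/-- Among all finite sets, the set of the indices with nonnegative terms maximizes the sum, and it
contains every other maximizer. -/
theorem sum_le_sum_of_mem_iff_nonneg {ι : Type*} [Fintype ι] [DecidableEq ι] {T T' : Finset ι}
    {a : ι → ℝ} (hT' : ∀ i, i ∈ T' ↔ 0 ≤ a i) :
    ∑ i ∈ T, a i ≤ ∑ i ∈ T', a i ∧ (∑ i ∈ T, a i = ∑ i ∈ T', a i → T ⊆ T') := by
  have hle : ∀ i ∈ Finset.univ, (if i ∈ T then a i else 0) ≤ (if i ∈ T' then a i else 0) := by
    intro i _
    have := hT' i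
    split_ifs with h1 h2 h2
    · exact le_rfl
    · exact (not_le.1 fun h => h2 (this.2 h)).le
    · exact this.1 h2
    · exact le_rfl
  have e : ∀ U : Finset ι, ∑ i ∈ U, a i = ∑ i, if i ∈ U then a i else 0 := fun U => by
    simp
  rw [e T, e T']
  refine ⟨Finset.sum_le_sum hle, fun h i hi => ?_⟩
  have h2 := (Finset.sum_eq_sum_iff_of_le hle).1 h i (Finset.mem_univ i)
  by_contra hi'
  rw [if_pos hi, if_neg hi'] at h2
  exact hi' ((hT' i).2 h2.ge)

/-- A real quantity that is eventually monotone along a sequence in a finite type is eventually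
constant. -/
theorem exists_eventually_const_of_finite {α : Type*} [Finite α] (π : ℕ → α) (v : α → ℝ) {N : ℕ}
    (hv : ∀ l ≥ N, v (π l) ≤ v (π (l + 1))) : ∃ L ≥ N, ∀ l ≥ L, v (π l) = v (π L) := by
  obtain ⟨a, ⟨L, hL, rfl⟩, hmax⟩ := Set.exists_max_image (π '' Set.Ici N) v (Set.toFinite _)
    ⟨π N, N, Set.mem_Ici.2 le_rfl, rfl⟩
  refine ⟨L, hL, fun l hl => le_antisymm (hmax _ ⟨l, le_trans hL hl, rfl⟩) ?_⟩
  induction l, hl using Nat.le_induction with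
  | base => exact le_rfl
  | succ l hl ih => exact ih.trans (hv l (le_trans hL hl))

/-- A Chebyshev inequality: if `p` dominates `p'` in the likelihood ratio order, then the mean of
a decreasing function is at least as large under `p'`. -/
theorem chebyshev_likelihood_ratio {ι : Type*} [Fintype ι] [LinearOrder ι] {p p' h : ι → ℝ}
    (hp : ∀ s t, t < s → p t * p' s ≤ p s * p' t) (hh : ∀ s t, t < s → h s < h t) :
    (∑ s, p' s) * ∑ s, p s * h s ≤ (∑ s, p s) * ∑ s, p' s * h s ∧
      ((∑ s, p' s) * ∑ s, p s * h s = (∑ s, p s) * ∑ s, p' s * h s →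
        ∀ s t, t < s → p t * p' s = p s * p' t) := by
  -- Symmetrization over pairs of states: each term is a product of two factors of the same sign.
  -- Strict monotonicity of `h` then settles the equality case.
  have key : 2 * ((∑ s, p s) * ∑ s, p' s * h s - (∑ s, p' s) * ∑ s, p s * h s) =
      ∑ x : ι × ι, (p x.1 * p' x.2 - p x.2 * p' x.1) * (h x.2 - h x.1) := by
    have e1 := Fintype.sum_mul_sum p (fun s => p' s * h s)
    have e2 := Fintype.sum_mul_sum p' (fun s => p s * h s)
    have e3 : (∑ s, p s) * ∑ s, p' s * h s = ∑ s, ∑ t, p t * (p' s * h s) := by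
      rw [e1, Finset.sum_comm]
    have e4 : (∑ s, p' s) * ∑ s, p s * h s = ∑ s, ∑ t, p' t * (p s * h s) := by
      rw [e2, Finset.sum_comm]
    rw [Fintype.sum_prod_type]
    have : ∀ s t, (p s * p' t - p t * p' s) * (h t - h s) =
        p s * (p' t * h t) + p t * (p' s * h s) - p' s * (p t * h t) - p' t * (p s * h s) :=
      fun s t => by ring
    simp only [this, Finset.sum_sub_distrib, Finset.sum_add_distrib]
    rw [← e1, ← e2, ← e3, ← e4]
    ring
  have hnn : ∀ x ∈ (Finset.univ : Finset (ι × ι)),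
      0 ≤ (p x.1 * p' x.2 - p x.2 * p' x.1) * (h x.2 - h x.1) := by
    rintro ⟨s, t⟩ -
    rcases lt_trichotomy t s with hlt | rfl | hlt
    · exact mul_nonneg (sub_nonneg.2 (hp s t hlt)) (sub_nonneg.2 (hh s t hlt).le)
    · simp
    · refine mul_nonneg_of_nonpos_of_nonpos (sub_nonpos.2 ?_) (sub_nonpos.2 (hh t s hlt).le)
      exact hp t s hlt
  have hsum := Finset.sum_nonneg hnn
  refine ⟨by linarith, fun e s t hlt => ?_⟩
  have h0 : ∑ x : ι × ι, (p x.1 * p' x.2 - p x.2 * p' x.1) * (h x.2 - h x.1) = 0 := by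
    rw [← key, e]; ring
  have := (Finset.sum_eq_zero_iff_of_nonneg hnn).1 h0 (s, t) (Finset.mem_univ _)
  rcases mul_eq_zero.1 this with h1 | h1
  · simp only at h1; linarith
  · exact absurd (hh s t hlt) (by simp only at h1; linarith)

namespace AdmissionQueue

variable {m c S : ℕ} (Q : AdmissionQueue m c S)

/-! ### Policy iteration -/

/-- The decrements do not depend on the chosen solution, so a step can be tested on any one of them;
this is why policy iteration is well defined. -/
theorem isPIStep_iff {π π' : AdmissionPolicy m S} {ρ : ℝ} {h : Fin (S + 1) → ℝ}
    (H : Q.SolvesEvaluation π ρ h) :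
    Q.IsPIStep π π' ↔ ∀ (s : Fin S) (i : Fin m), i ∈ π' s ↔ drop h s ≤ Q.netReward i s := by
  constructor
  · rintro ⟨ρ₁, h₁, H₁, hstep⟩ s i
    rw [hstep s i, ← drop_coe, (Q.poisson_unique H.poisson H₁.poisson).2 s s.2]
  · intro hstep
    exact ⟨ρ, h, H, fun s i => by rw [hstep s i, drop_coe]⟩

theorem exists_isPIStep (π : AdmissionPolicy m S) : ∃ π', Q.IsPIStep π π' := by
  classical
  obtain ⟨ρ, h, H⟩ := Q.exists_solvesEvaluation π
  exact ⟨fun s => {i | drop h s ≤ Q.netReward i s}, (Q.isPIStep_iff H).2 (by simp)⟩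

theorem exists_isPIRun (π₀ : AdmissionPolicy m S) :
    ∃ π : ℕ → AdmissionPolicy m S, π 0 = π₀ ∧ Q.IsPIRun π := by
  choose F hF using Q.exists_isPIStep
  refine ⟨fun l => F^[l] π₀, rfl, fun l => ?_⟩
  simp only [Function.iterate_succ_apply']
  exact hF _

/-- The net rate is a sum over admitted classes. Admitting exactly the nonnegative terms, ties
included, gives the largest maximizer. -/
theorem greedy_le {π' : AdmissionPolicy m S} {d : ℕ → ℝ}
    (hπ' : ∀ (s : Fin S) (i : Fin m), i ∈ π' s ↔ d s ≤ Q.netReward i s)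
    (π : AdmissionPolicy m S) {s : ℕ} (hs : s < S) :
    natExt (Q.rewardRate π) s - natExt (Q.birthRate π) s * d s ≤
        natExt (Q.rewardRate π') s - natExt (Q.birthRate π') s * d s ∧
      (natExt (Q.rewardRate π) s - natExt (Q.birthRate π) s * d s =
        natExt (Q.rewardRate π') s - natExt (Q.birthRate π') s * d s →
        π ⟨s, hs⟩ ⊆ π' ⟨s, hs⟩) := by
  simp only [rewardRate_sub_birthRate_mul, hs]
  refine sum_le_sum_of_mem_iff_nonneg fun i => ?_
  rw [hπ', mul_nonneg_iff_of_pos_left (Q.arrivalRate_pos i), sub_nonneg]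

theorem greedy_le_of_le {π' : AdmissionPolicy m S} {d : ℕ → ℝ}
    (hπ' : ∀ (s : Fin S) (i : Fin m), i ∈ π' s ↔ d s ≤ Q.netReward i s)
    (π : AdmissionPolicy m S) (s : ℕ) (hs : s ≤ S) :
    natExt (Q.rewardRate π) s - natExt (Q.birthRate π) s * d s ≤
        natExt (Q.rewardRate π') s - natExt (Q.birthRate π') s * d s := by
  rcases hs.eq_or_lt with rfl | hs
  · rw [rewardRate_sub_birthRate_mul_last, rewardRate_sub_birthRate_mul_last]
  · exact (Q.greedy_le hπ' π hs).1

theorem IsPIStep.improves {π π' : AdmissionPolicy m S} {ρ ρ' : ℝ} {h h' : Fin (S + 1) → ℝ}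
    (hstep : Q.IsPIStep π π') (H : Q.SolvesEvaluation π ρ h) (H' : Q.SolvesEvaluation π' ρ' h') :
    ρ ≤ ρ' ∧ (ρ' = ρ → ∀ s < S, drop h' s ≤ drop h s) :=
  H.poisson.comparison H'.poisson (fun s _ => Q.deathRate_pos s) (Q.natExt_birthRate_nonneg π')
    (Q.natExt_birthRate_last π') (Q.greedy_le_of_le ((Q.isPIStep_iff H).1 hstep) π)

/-- A fixed policy is greedy for its own decrements, so no policy does better against them. -/
theorem IsPIStep.dominates {π π' : AdmissionPolicy m S} {ρ ρ' : ℝ} {h h' : Fin (S + 1) → ℝ}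
    (hfix : Q.IsPIStep π π) (H : Q.SolvesEvaluation π ρ h) (H' : Q.SolvesEvaluation π' ρ' h') :
    ρ' ≤ ρ ∧ (ρ' = ρ → ∀ s < S, drop h s ≤ drop h' s) :=
  H.poisson.comparison_le H'.poisson (fun s _ => Q.deathRate_pos s)
    (Q.natExt_birthRate_nonneg π') (Q.natExt_birthRate_last π')
    (Q.greedy_le_of_le ((Q.isPIStep_iff H).1 hfix) π')

theorem IsPIStep.fixed_unique {π π' : AdmissionPolicy m S} (hπ : Q.IsPIStep π π)
    (hπ' : Q.IsPIStep π' π') : π = π' := by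
  obtain ⟨ρ, h, H⟩ := Q.exists_solvesEvaluation π
  obtain ⟨ρ', h', H'⟩ := Q.exists_solvesEvaluation π'
  have h1 := hπ.dominates Q H H'
  have h2 := hπ'.dominates Q H' H
  have e : ρ' = ρ := le_antisymm h1.1 h2.1
  have hd : ∀ s < S, drop h s = drop h' s :=
    fun s hs => le_antisymm (h1.2 e s hs) (h2.2 e.symm s hs)
  funext s
  ext i
  rw [(Q.isPIStep_iff H).1 hπ, (Q.isPIStep_iff H').1 hπ', hd s s.2]

theorem IsPIRun.eventually_fixed {π : ℕ → AdmissionPolicy m S} (hrun : Q.IsPIRun π) :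
    ∃ L, ∀ l ≥ L, Q.IsPIStep (π l) (π l) := by
  choose ρ h H using Q.exists_solvesEvaluation
  obtain ⟨L₁, -, hL₁⟩ := exists_eventually_const_of_finite π ρ (N := 0)
    (fun l _ => ((hrun l).improves Q (H _) (H _)).1)
  have hle : ∀ l ≥ L₁, ∀ s < S, drop (h (π (l + 1))) s ≤ drop (h (π l)) s := fun l hl =>
    ((hrun l).improves Q (H _) (H _)).2 (by rw [hL₁ l hl, hL₁ (l + 1) (by omega)])
  -- Once the gain is constant the decrements decrease in each state, so their sum serves as a
  -- second potential. When it is constant too, all decrements agree, and the policy greedy for the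
  -- previous ones is greedy for its own.
  obtain ⟨L₂, hL₂, hc⟩ := exists_eventually_const_of_finite π
    (fun π => -∑ s : Fin S, drop (h π) s) (N := L₁)
    (fun l hl => neg_le_neg (Finset.sum_le_sum fun s _ => hle l hl s s.2))
  refine ⟨L₂ + 1, fun l hl => ?_⟩
  obtain ⟨l, rfl⟩ : ∃ k, l = k + 1 := ⟨l - 1, by omega⟩
  have hsum : ∑ s : Fin S, drop (h (π (l + 1))) s = ∑ s : Fin S, drop (h (π l)) s := by
    have h1 := hc l (by omega)
    have h2 := hc (l + 1) (by omega)
    linarith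
  have heq := (Finset.sum_eq_sum_iff_of_le
    (fun (s : Fin S) _ => hle l (by omega) s s.2)).1 hsum
  refine (Q.isPIStep_iff (H _)).2 fun s i => ?_
  rw [heq s (Finset.mem_univ s)]
  exact (Q.isPIStep_iff (H _)).1 (hrun l) s i

theorem exists_isPIStep_self : ∃ π : AdmissionPolicy m S, Q.IsPIStep π π := by
  obtain ⟨π, -, hπ⟩ := Q.exists_isPIRun fun _ => ∅
  obtain ⟨L, hL⟩ := hπ.eventually_fixed
  exact ⟨π L, hL L le_rfl⟩

theorem isGainOptimal_iff {πb π : AdmissionPolicy m S} {ρ ρ' : ℝ} {h h' : Fin (S + 1) → ℝ}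
    (hfix : Q.IsPIStep πb πb) (H : Q.SolvesEvaluation πb ρ h) (H' : Q.SolvesEvaluation π ρ' h') :
    Q.IsGainOptimal π ↔ ρ' = ρ := by
  constructor
  · rintro ⟨ρ₁, h₁, hopt⟩
    obtain ⟨ρ₂, h₂, hle⟩ := hopt πb
    rw [h₁.eq Q H'.isGain, h₂.eq Q H.isGain] at hle
    exact le_antisymm (hfix.dominates Q H H').1 hle
  · rintro rfl
    refine ⟨ρ', H'.isGain, fun π' => ?_⟩
    obtain ⟨ρ₂, h₂, H₂⟩ := Q.exists_solvesEvaluation π'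
    exact ⟨ρ₂, H₂.isGain, (hfix.dominates Q H H₂).1⟩

/-! ### Monotonicity of the optimal relative values -/

theorem netReward_anti {i : Fin m} {s : ℕ} (hs : s + 1 < S) :
    Q.netReward i (s + 1) ≤ Q.netReward i s :=
  sub_le_sub_left (Q.cost_mono i s hs) _

theorem netReward_eq_of_lt {i : Fin m} {s : ℕ} (hs : s < c) :
    Q.netReward i s = Q.netReward i 0 := by
  simp [netReward, waitLaw, hs, Q.servers_pos]

/-- The largest reward rate in state `s` net of the cost `x` of one more job. -/
noncomputable def surplus (s : ℕ) (x : ℝ) : ℝ :=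
  if s < S then ∑ i, Q.arrivalRate i * max (Q.netReward i s - x) 0 else 0

theorem surplus_nonneg (s : ℕ) (x : ℝ) : 0 ≤ Q.surplus s x := by
  unfold surplus
  split_ifs
  · exact Finset.sum_nonneg fun i _ => mul_nonneg (Q.arrivalRate_pos i).le (le_max_right _ _)
  · exact le_rfl

theorem surplus_last (x : ℝ) : Q.surplus S x = 0 := by simp [surplus]

theorem surplus_anti (s : ℕ) {x y : ℝ} (h : x ≤ y) : Q.surplus s y ≤ Q.surplus s x := by
  unfold surplus
  split_ifs
  · refine Finset.sum_le_sum fun i _ => mul_le_mul_of_nonneg_left ?_ (Q.arrivalRate_pos i).le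
    exact max_le_max_right _ (by linarith)
  · exact le_rfl

theorem surplus_succ_le (s : ℕ) (x : ℝ) : Q.surplus (s + 1) x ≤ Q.surplus s x := by
  by_cases h : s + 1 < S
  · rw [surplus, surplus, if_pos h, if_pos (by omega)]
    refine Finset.sum_le_sum fun i _ => mul_le_mul_of_nonneg_left ?_ (Q.arrivalRate_pos i).le
    exact max_le_max_right _ (sub_le_sub_right (Q.netReward_anti h) _)
  · rw [surplus, if_neg h]
    exact Q.surplus_nonneg s x

theorem surplus_succ_eq {s : ℕ} (hs : s + 1 < S) (hc : s + 1 < c) (x : ℝ) :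
    Q.surplus (s + 1) x = Q.surplus s x := by
  have hs' : s < S := by omega
  simp only [surplus, hs, hs', if_true, Q.netReward_eq_of_lt hc,
    Q.netReward_eq_of_lt (show s < c by omega)]

theorem surplus_strictAnti {s : ℕ} {x y : ℝ} (hxy : x < y) (hy : 0 < Q.surplus s y) :
    Q.surplus s y < Q.surplus s x := by
  unfold surplus at *
  split_ifs at * with hs
  · obtain ⟨i, hi, hpos⟩ := Finset.exists_lt_of_sum_lt (s := Finset.univ)
      (f := fun _ : Fin m => (0 : ℝ))
      (by simpa using hy)
    refine Finset.sum_lt_sum (fun j _ => mul_le_mul_of_nonneg_left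
      (max_le_max_right _ (by linarith)) (Q.arrivalRate_pos j).le) ⟨i, hi, ?_⟩
    refine mul_lt_mul_of_pos_left ?_ (Q.arrivalRate_pos i)
    have : 0 < max (Q.netReward i s - y) 0 := (mul_pos_iff_of_pos_left (Q.arrivalRate_pos i)).1 hpos
    have h2 : 0 < Q.netReward i s - y := by
      rcases lt_max_iff.1 this with h | h
      · exact h
      · exact absurd h (lt_irrefl _)
    rw [max_eq_left h2.le]
    exact lt_max_of_lt_left (by linarith)
  · exact absurd hy (lt_irrefl _)

/-- The average reward optimality equation. -/
structure OptimalityEquation (ρ : ℝ) (d : ℕ → ℝ) : Prop where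
  zero : ρ = Q.surplus 0 (d 0)
  succ : ∀ s < S, ρ = Q.surplus (s + 1) (d (s + 1)) + Q.deathRate (s + 1) * d s

theorem IsPIStep.optimalityEquation {π : AdmissionPolicy m S} {ρ : ℝ} {h : Fin (S + 1) → ℝ}
    (hfix : Q.IsPIStep π π) (H : Q.SolvesEvaluation π ρ h) :
    Q.OptimalityEquation ρ (drop h) := by
  have key : ∀ s ≤ S, natExt (Q.rewardRate π) s - natExt (Q.birthRate π) s * drop h s =
      Q.surplus s (drop h s) := by
    intro s hs
    rcases hs.eq_or_lt with rfl | hs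
    · rw [rewardRate_sub_birthRate_mul_last, surplus_last]
    · rw [Q.rewardRate_sub_birthRate_mul π hs, surplus, if_pos hs,
        ← Finset.sum_subset (Finset.subset_univ (π ⟨s, hs⟩))]
      · refine Finset.sum_congr rfl fun i hi => ?_
        rw [max_eq_left (sub_nonneg.2 (((Q.isPIStep_iff H).1 hfix _ i).1 hi))]
      · intro i _ hi
        rw [(Q.isPIStep_iff H).1 hfix, not_le] at hi
        rw [max_eq_right (sub_nonpos.2 hi.le), mul_zero]
  refine ⟨?_, fun s hs => ?_⟩
  · rw [← key 0 (Nat.zero_le _)]; exact H.poisson.zero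
  · rw [← key (s + 1) hs]; exact H.poisson.succ s hs

namespace OptimalityEquation

variable {Q} {ρ : ℝ} {d : ℕ → ℝ}

theorem gain_pos (E : Q.OptimalityEquation ρ d) (hS : 0 < S) (hpos : ∃ i, 0 < Q.netReward i 0) :
    0 < ρ := by
  by_contra! hρ
  have h0 : d 0 ≤ 0 := by
    have h1 := E.succ 0 hS
    have h2 := Q.surplus_nonneg (0 + 1) (d (0 + 1))
    by_contra! hd
    have := mul_pos (Q.deathRate_pos 0) hd
    linarith
  obtain ⟨i, hi⟩ := hpos
  have h1 := E.zero
  rw [surplus, if_pos hS] at h1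
  have h2 : 0 < Q.arrivalRate i * max (Q.netReward i 0 - d 0) 0 :=
    mul_pos (Q.arrivalRate_pos i) (lt_max_of_lt_left (by linarith))
  have h3 := Finset.single_le_sum (f := fun i => Q.arrivalRate i * max (Q.netReward i 0 - d 0) 0)
    (fun j _ => mul_nonneg (Q.arrivalRate_pos j).le (le_max_right _ _)) (Finset.mem_univ i)
  linarith

/-- If `d 0 ≤ 0`, the equation forces the surplus to stay at least `ρ > 0` in each successive state
while `d` keeps decreasing; this contradicts the zero surplus of the full state. -/
theorem drop_zero_pos (E : Q.OptimalityEquation ρ d) (hS : 0 < S)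
    (hpos : ∃ i, 0 < Q.netReward i 0) : 0 < d 0 := by
  have hρ := E.gain_pos hS hpos
  by_contra! h0
  have main : ∀ s < S, d s ≤ 0 ∧ ρ ≤ Q.surplus s (d s) ∧
      Q.surplus s (d s) ≤ ρ - Q.deathRate (s + 1) * d s := by
    intro s
    induction s with
    | zero =>
      intro _
      have h1 := E.zero
      have h2 := mul_nonneg (Q.deathRate_nonneg (0 + 1)) (neg_nonneg.2 h0)
      exact ⟨h0, by linarith, by linarith⟩
    | succ s ih =>
      intro hs
      obtain ⟨h1, h2, h3⟩ := ih (by omega)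
      have h4 := E.succ s (by omega)
      have h5 := Q.surplus_succ_le s (d s)
      have h6 : d (s + 1) ≤ d s := by
        by_contra! hlt
        have := Q.surplus_strictAnti (s := s + 1) hlt (by linarith)
        linarith
      have h7 : Q.deathRate (s + 1) * -d s ≤ Q.deathRate (s + 1 + 1) * -d (s + 1) :=
        mul_le_mul (Q.deathRate_mono (by omega)) (by linarith) (by linarith)
          (Q.deathRate_nonneg _)
      exact ⟨by linarith, by linarith, by linarith⟩
  obtain ⟨n, rfl⟩ : ∃ n, S = n + 1 := ⟨S - 1, by omega⟩
  obtain ⟨-, h2, h3⟩ := main n (by omega)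
  have h4 := E.succ n (by omega)
  rw [surplus_last] at h4
  linarith

/-- Below `c` the surplus function does not depend on the state. A decrease of `d` would raise the
surplus while the death term also rises strictly, contradicting that their sum is `ρ`. -/
theorem drop_mono_of_lt (E : Q.OptimalityEquation ρ d) (h0 : 0 < d 0) :
    ∀ s, s + 1 < S → s + 1 < c → 0 < d s ∧ d s ≤ d (s + 1) := by
  intro s
  induction s with
  | zero =>
    intro hs hc
    refine ⟨h0, ?_⟩
    have h1 := E.zero
    have h2 := E.succ 0 (by omega)
    rw [Q.surplus_succ_eq hs hc] at h2
    by_contra! hlt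
    have h3 := Q.surplus_anti 0 hlt.le
    have h4 := mul_pos (Q.deathRate_pos 0) h0
    linarith
  | succ s ih =>
    intro hs hc
    obtain ⟨h1, h2⟩ := ih (by omega) (by omega)
    refine ⟨by linarith, ?_⟩
    have h3 := E.succ s (by omega)
    have h4 := E.succ (s + 1) (by omega)
    rw [Q.surplus_succ_eq hs hc] at h4
    by_contra! hlt
    have h5 := Q.surplus_anti (s + 1) hlt.le
    have h6 : Q.deathRate (s + 1) * d s < Q.deathRate (s + 1 + 1) * d (s + 1) := by
      refine mul_lt_mul ?_ h2 h1 (Q.deathRate_nonneg _)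
      have : min (s + 1) c < min (s + 1 + 1) c := by omega
      exact mul_lt_mul_of_pos_right (by exact_mod_cast this) Q.serviceRate_pos
    linarith

/-- Here the death rates are equal, so monotonicity of `d` is equivalent to the surplus decreasing
one state higher, which propagates backward from its zero value at `S`. -/
theorem drop_mono_of_ge (E : Q.OptimalityEquation ρ d) {s : ℕ} (hs : s + 1 < S)
    (hc : c ≤ s + 1) : d s ≤ d (s + 1) := by
  have step : ∀ s, s + 1 < S → c ≤ s + 1 →
      Q.surplus (s + 1 + 1) (d (s + 1 + 1)) ≤ Q.surplus (s + 1) (d (s + 1)) →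
      d s ≤ d (s + 1) := by
    intro s hs hc h
    have h1 := E.succ s (by omega)
    have h2 := E.succ (s + 1) (by omega)
    have e : Q.deathRate (s + 1 + 1) = Q.deathRate (s + 1) := by
      unfold deathRate
      rw [min_eq_right (by omega : c ≤ s + 1 + 1), min_eq_right hc]
    rw [e] at h2
    exact le_of_mul_le_mul_left (by linarith) (Q.deathRate_pos s)
  have main : ∀ k s, s + 1 + k = S → c ≤ s →
      Q.surplus (s + 1) (d (s + 1)) ≤ Q.surplus s (d s) := by
    intro k
    induction k with
    | zero =>
      intro s hs _
      have : Q.surplus (s + 1) (d (s + 1)) = 0 := by simp [surplus, ← hs]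
      rw [this]
      exact Q.surplus_nonneg _ _
    | succ k ih =>
      intro s hs hc
      have := step s (by omega) (by omega) (ih (s + 1) (by omega) (by omega))
      exact (Q.surplus_anti _ this).trans (Q.surplus_succ_le _ _)
  exact step s hs hc (main (S - (s + 1 + 1)) (s + 1) (by omega) hc)

theorem drop_mono (E : Q.OptimalityEquation ρ d) (hpos : ∃ i, 0 < Q.netReward i 0) {s : ℕ}
    (hs : s + 1 < S) : d s ≤ d (s + 1) := by
  rcases lt_or_ge (s + 1) c with hc | hc
  · exact (E.drop_mono_of_lt (E.drop_zero_pos (by omega) hpos) s hs hc).2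
  · exact E.drop_mono_of_ge hs hc

theorem drop_pos (E : Q.OptimalityEquation ρ d) (hpos : ∃ i, 0 < Q.netReward i 0) :
    ∀ s < S, 0 < d s := by
  intro s
  induction s with
  | zero => exact fun hs => E.drop_zero_pos hs hpos
  | succ s ih => exact fun hs => (ih (by omega)).trans_le (E.drop_mono hpos hs)

end OptimalityEquation

/-- The limit of policy iteration admits fewer classes in higher states. -/
theorem IsPIStep.mem_of_le {π : AdmissionPolicy m S} (hfix : Q.IsPIStep π π)
    (hpos : ∃ i, 0 < Q.netReward i 0) {i : Fin m} {s t : ℕ} (hst : s ≤ t) (ht : t < S)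
    (hi : i ∈ π ⟨t, ht⟩) : i ∈ π ⟨s, by omega⟩ := by
  obtain ⟨ρ, h, H⟩ := Q.exists_solvesEvaluation π
  have E := hfix.optimalityEquation Q H
  have hmem := (Q.isPIStep_iff H).1 hfix
  induction t, hst using Nat.le_induction with
  | base => exact hi
  | succ t _ ih =>
    refine ih (by omega) ?_
    rw [hmem] at hi ⊢
    exact (E.drop_mono hpos ht).trans (hi.trans (Q.netReward_anti ht))

theorem IsPIStep.exists_isTrunkReservation {π : AdmissionPolicy m S} (hfix : Q.IsPIStep π π)
    (hpos : ∃ i, 0 < Q.netReward i 0) : ∃ M, IsTrunkReservation π M := by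
  classical
  have hex : ∀ i : Fin m, ∃ n, ∀ hn : n < S, i ∉ π ⟨n, hn⟩ := fun i => ⟨S, by simp⟩
  -- The level is the first state that rejects the class, or `S` if none does.
  refine ⟨fun i => Nat.find (hex i), fun i => Nat.find_min' _ (by simp), fun s i => ?_⟩
  rw [Nat.lt_find_iff]
  constructor
  · intro hi n hn hnot
    exact hnot (by omega) (hfix.mem_of_le Q hpos hn s.2 hi)
  · intro hall
    have := hall s le_rfl
    push Not at this
    exact this.2

/-! ### Stationary distributions and the bias -/

/-- The unnormalized stationary distribution of a policy. -/
noncomputable def weight (π : AdmissionPolicy m S) (s : ℕ) : ℝ :=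
  ∏ j ∈ Finset.range s, natExt (Q.birthRate π) j / Q.deathRate (j + 1)

theorem weight_zero (π : AdmissionPolicy m S) : Q.weight π 0 = 1 := by simp [weight]

theorem weight_succ (π : AdmissionPolicy m S) (s : ℕ) :
    Q.weight π (s + 1) = Q.weight π s * (natExt (Q.birthRate π) s / Q.deathRate (s + 1)) :=
  Finset.prod_range_succ _ _

theorem weight_nonneg (π : AdmissionPolicy m S) (s : ℕ) : 0 ≤ Q.weight π s :=
  Finset.prod_nonneg fun j _ => div_nonneg (Q.natExt_birthRate_nonneg π j) (Q.deathRate_nonneg _)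

theorem weight_ne_zero_iff (π : AdmissionPolicy m S) (s : ℕ) :
    Q.weight π s ≠ 0 ↔ ∀ j < s, 0 < natExt (Q.birthRate π) j := by
  rw [weight, Finset.prod_ne_zero_iff]
  refine forall_congr' fun j => ?_
  rw [Finset.mem_range, ne_eq, div_eq_zero_iff, or_iff_left (Q.deathRate_pos j).ne']
  exact imp_congr_right fun _ => ⟨fun h => (Q.natExt_birthRate_nonneg π j).lt_of_ne' h,
    fun h => h.ne'⟩

theorem sum_weight_pos (π : AdmissionPolicy m S) : 0 < ∑ s : Fin (S + 1), Q.weight π s :=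
  Finset.sum_pos' (fun s _ => Q.weight_nonneg π s)
    ⟨0, Finset.mem_univ _, by simp [weight_zero]⟩

/-- Detailed balance: tested against any `h`, the birth term at `s` cancels the death term at `s +
1`. -/
theorem vecMul_weight (π : AdmissionPolicy m S) :
    Matrix.vecMul (fun s : Fin (S + 1) => Q.weight π s) (Q.generator π) = 0 := by
  refine dotProduct_eq_zero _ fun h => ?_
  rw [← Matrix.dotProduct_mulVec]
  simp only [dotProduct, generator_mulVec, ← natExt_coe (Q.birthRate π)]
  rw [Fin.sum_univ_eq_sum_range (fun s => Q.weight π s *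
    (-(natExt (Q.birthRate π) s * drop h s) + Q.deathRate s * drop h (s - 1)))]
  simp only [mul_add, Finset.sum_add_distrib]
  rw [Finset.sum_range_succ, Finset.sum_range_succ', natExt_birthRate_last, deathRate_zero]
  simp only [zero_mul, neg_zero, mul_zero, add_zero, Nat.add_sub_cancel]
  rw [← Finset.sum_add_distrib]
  refine Finset.sum_eq_zero fun s _ => ?_
  have := (Q.deathRate_pos s).ne'
  rw [weight_succ]
  field_simp
  ring

theorem isStationary_weight (π : AdmissionPolicy m S) :
    Q.IsStationary π fun s => (∑ s : Fin (S + 1), Q.weight π s)⁻¹ * Q.weight π s := by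
  have hW := Q.sum_weight_pos π
  refine ⟨fun s => mul_nonneg (inv_nonneg.2 hW.le) (Q.weight_nonneg π s), ?_, ?_⟩
  · rw [← Finset.mul_sum, inv_mul_cancel₀ hW.ne']
  · have := Matrix.smul_vecMul (∑ s : Fin (S + 1), Q.weight π s)⁻¹
      (fun s : Fin (S + 1) => Q.weight π s) (Q.generator π)
    rw [vecMul_weight, smul_zero] at this
    exact this

/-- Pairing a stationary law with the Poisson equation for the reward `f` shows that its mean of `f`
is the constant `ρ`, whatever the law. -/
theorem IsStationary.sum_eq {π : AdmissionPolicy m S} {ν ν' : Fin (S + 1) → ℝ}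
    (hν : Q.IsStationary π ν) (hν' : Q.IsStationary π ν') (f : Fin (S + 1) → ℝ) :
    ∑ s, ν s * f s = ∑ s, ν' s * f s := by
  obtain ⟨ρ, h, H⟩ := Q.exists_poisson π f
  have key : ∀ ν, Q.IsStationary π ν → ∑ s, ν s * f s = ρ := by
    rintro ν ⟨-, h1, h2⟩
    have h3 : ∑ s, ν s * Matrix.mulVec (Q.generator π) h s = 0 := by
      change dotProduct ν (Matrix.mulVec (Q.generator π) h) = 0
      rw [Matrix.dotProduct_mulVec, h2, zero_dotProduct]
    have h4 : ∑ s, ν s * ρ = ρ := by rw [← Finset.sum_mul, h1, one_mul]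
    have h5 : ∑ s, ν s * ρ = ∑ s, ν s * f s + ∑ s, ν s * Matrix.mulVec (Q.generator π) h s := by
      rw [← Finset.sum_add_distrib]
      exact Finset.sum_congr rfl fun s _ => by rw [← mul_add, ← H s]
    linarith
  rw [key ν hν, key ν' hν']

theorem isBias_iff {π : AdmissionPolicy m S} {ρ : ℝ} {h₀ : Fin (S + 1) → ℝ}
    (H₀ : Q.SolvesEvaluation π ρ h₀) {h : Fin (S + 1) → ℝ} :
    Q.IsBias π h ↔ Q.SolvesEvaluation π ρ h ∧ ∑ s : Fin (S + 1), Q.weight π s * h s = 0 := by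
  have hW := Q.sum_weight_pos π
  have e : ∑ s : Fin (S + 1), (∑ s : Fin (S + 1), Q.weight π s)⁻¹ * Q.weight π s * h s =
      (∑ s : Fin (S + 1), Q.weight π s)⁻¹ * ∑ s : Fin (S + 1), Q.weight π s * h s := by
    rw [Finset.mul_sum]
    exact Finset.sum_congr rfl fun s _ => by ring
  constructor
  · rintro ⟨⟨ρ', hg, H⟩, ν, hν, hsum⟩
    rw [hg.eq Q H₀.isGain] at H
    refine ⟨H, ?_⟩
    rw [hν.sum_eq Q (Q.isStationary_weight π) h, e] at hsum
    exact (mul_eq_zero.1 hsum).resolve_left (inv_ne_zero hW.ne')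
  · rintro ⟨H, hsum⟩
    exact ⟨⟨ρ, H.isGain, H⟩, _, Q.isStationary_weight π, by rw [e, hsum, mul_zero]⟩

theorem exists_isBias (π : AdmissionPolicy m S) : ∃ h, Q.IsBias π h := by
  obtain ⟨ρ, h, H⟩ := Q.exists_solvesEvaluation π
  have hW := Q.sum_weight_pos π
  refine ⟨_, (Q.isBias_iff H).2 ⟨H.add_const Q (-((∑ s : Fin (S + 1), Q.weight π s * h s) /
    ∑ s : Fin (S + 1), Q.weight π s)), ?_⟩⟩
  simp only [mul_add, Finset.sum_add_distrib, ← Finset.sum_mul]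
  field_simp
  ring

theorem IsBias.unique {π : AdmissionPolicy m S} {h h' : Fin (S + 1) → ℝ} (H : Q.IsBias π h)
    (H' : Q.IsBias π h') : h = h' := by
  obtain ⟨ρ, h₀, H₀⟩ := Q.exists_solvesEvaluation π
  obtain ⟨H, hs⟩ := (Q.isBias_iff H₀).1 H
  obtain ⟨H', hs'⟩ := (Q.isBias_iff H₀).1 H'
  have hd := (Q.poisson_unique H'.poisson H.poisson).2
  have hc := eq_const_of_drop_eq_zero (h := fun s => h s - h' s) (fun s hs => by
    have := hd s hs
    simp only [drop, hs, dif_pos] at this ⊢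
    linarith)
  have hz : (∑ s : Fin (S + 1), Q.weight π s) * (h 0 - h' 0) = 0 := by
    rw [Finset.sum_mul, ← sub_eq_zero.2 (hs.trans hs'.symm), ← Finset.sum_sub_distrib]
    exact Finset.sum_congr rfl fun s _ => by rw [← mul_sub, hc s]
  have hz' := (mul_eq_zero.1 hz).resolve_left (Q.sum_weight_pos π).ne'
  funext s
  have := hc s
  linarith

/-! ### Comparison with gain optimal policies -/

section

variable {Q} {πb π : AdmissionPolicy m S} {ρ : ℝ} {h h' : Fin (S + 1) → ℝ}

/-- In the states it reaches, a gain optimal policy admits no more than the limit of policy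
iteration. -/
theorem IsPIStep.subset_of_reachable (hfix : Q.IsPIStep πb πb) (H : Q.SolvesEvaluation πb ρ h)
    (H' : Q.SolvesEvaluation π ρ h') {s : ℕ} (hs : s < S) (hr : Q.weight π s ≠ 0) :
    π ⟨s, hs⟩ ⊆ πb ⟨s, hs⟩ :=
  (Q.greedy_le ((Q.isPIStep_iff H).1 hfix) π hs).2
    (H.poisson.eq_of_reachable H'.poisson (fun s _ => Q.deathRate_pos s)
      (Q.natExt_birthRate_nonneg π) (Q.natExt_birthRate_last π)
      (Q.greedy_le_of_le ((Q.isPIStep_iff H).1 hfix) π) s hs.le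
      ((Q.weight_ne_zero_iff π s).1 hr)).1

variable (Q) in
theorem birthRate_le_of_subset {s : ℕ} {hs : s < S} (hsub : π ⟨s, hs⟩ ⊆ πb ⟨s, hs⟩) :
    natExt (Q.birthRate π) s ≤ natExt (Q.birthRate πb) s := by
  rw [Q.natExt_birthRate π hs, Q.natExt_birthRate πb hs]
  exact Finset.sum_le_sum_of_subset_of_nonneg hsub fun i _ _ => (Q.arrivalRate_pos i).le

/-- Successive weight ratios are birth rate over death rate, and `π` has the smaller birth rate
wherever its weight is nonzero; elsewhere the left side vanishes. -/
theorem IsPIStep.weight_mul_le (hfix : Q.IsPIStep πb πb) (H : Q.SolvesEvaluation πb ρ h)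
    (H' : Q.SolvesEvaluation π ρ h') {t s : ℕ} (hts : t ≤ s) (hs : s ≤ S) :
    Q.weight πb t * Q.weight π s ≤ Q.weight πb s * Q.weight π t := by
  induction s, hts using Nat.le_induction with
  | base => exact le_rfl
  | succ s hts ih =>
    rw [weight_succ, weight_succ]
    by_cases hr : Q.weight π s = 0
    · rw [hr, zero_mul, mul_zero]
      exact mul_nonneg (mul_nonneg (Q.weight_nonneg _ _) (div_nonneg
        (Q.natExt_birthRate_nonneg _ _) (Q.deathRate_nonneg _))) (Q.weight_nonneg _ _)
    · have hb := Q.birthRate_le_of_subset (hfix.subset_of_reachable H H' hs hr)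
      rw [← mul_assoc, mul_right_comm (Q.weight πb s)]
      exact mul_le_mul (ih (by omega)) (div_le_div_of_nonneg_right hb (Q.deathRate_nonneg _))
        (div_nonneg (Q.natExt_birthRate_nonneg _ _) (Q.deathRate_nonneg _))
        (mul_nonneg (Q.weight_nonneg _ _) (Q.weight_nonneg _ _))

/-- The bias of a gain optimal policy is at most that of the limit of policy iteration, and it is
strictly smaller somewhere unless the policies agree. -/
theorem IsPIStep.bias_le (hfix : Q.IsPIStep πb πb) (hpos : ∃ i, 0 < Q.netReward i 0)
    (H : Q.SolvesEvaluation πb ρ h) (hs : ∑ s : Fin (S + 1), Q.weight πb s * h s = 0)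
    (H' : Q.SolvesEvaluation π ρ h') (hs' : ∑ s : Fin (S + 1), Q.weight π s * h' s = 0) :
    (∀ s, h' s ≤ h s) ∧ (h' = h → π = πb) := by
  have E := hfix.optimalityEquation Q H
  have hgreedy := Q.greedy_le_of_le ((Q.isPIStep_iff H).1 hfix) π
  have hreach := H.poisson.eq_of_reachable H'.poisson (fun s _ => Q.deathRate_pos s)
      (Q.natExt_birthRate_nonneg π) (Q.natExt_birthRate_last π) hgreedy
  have hdrop := (hfix.dominates Q H H').2 rfl
  have hanti : ∀ n ≤ S, ∀ t < n, natExt h n < natExt h t := by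
    intro n
    induction n with
    | zero => simp
    | succ n ih =>
      intro hn t ht
      have h1 := E.drop_pos hpos n hn
      have h2 := natExt_succ h hn
      rcases (Nat.lt_succ_iff.1 ht).eq_or_lt with rfl | hlt
      · linarith
      · linarith [ih (by omega) t hlt]
  have hcheb := chebyshev_likelihood_ratio (ι := Fin (S + 1)) (p := fun s => Q.weight πb s)
    (p' := fun s => Q.weight π s) (h := h)
    (fun s t hlt => hfix.weight_mul_le H H' (le_of_lt hlt) (by omega))
    (fun s t hlt => by
      rw [← natExt_coe h s, ← natExt_coe h t]
      exact hanti s (by omega) t hlt)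
  rw [hs, mul_zero] at hcheb
  have hconst : ∀ s ≤ S, (∀ j < s, drop h' j = drop h j) →
      natExt h' s - natExt h s = natExt h' 0 - natExt h 0 := by
    intro s
    induction s with
    | zero => simp
    | succ s ih =>
      intro hs hj
      rw [natExt_succ h' hs, natExt_succ h hs, hj s (by omega),
        ← ih (by omega) fun j hj' => hj j (by omega)]
      ring
  have hle0 : ∀ s ≤ S, natExt h' s - natExt h s ≤ natExt h' 0 - natExt h 0 := by
    intro s
    induction s with
    | zero => simp
    | succ s ih =>
      intro hs
      rw [natExt_succ h' hs, natExt_succ h hs]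
      linarith [ih (by omega), hdrop s hs]
  -- Only states reached by `π` carry weight, and there `h' - h` is constant; as `h'` has mean zero,
  -- the mean of `h` is minus that constant.
  have hκ : ∑ s : Fin (S + 1), Q.weight π s * h s =
      -((∑ s : Fin (S + 1), Q.weight π s) * (natExt h' 0 - natExt h 0)) := by
    rw [← sub_zero (∑ s : Fin (S + 1), Q.weight π s * h s), ← hs', ← Finset.sum_sub_distrib,
      Finset.sum_mul, ← Finset.sum_neg_distrib]
    refine Finset.sum_congr rfl fun s _ => ?_
    by_cases hr : Q.weight π s = 0
    · simp [hr]
    · rw [← hconst s (by omega) (hreach s (by omega) ((Q.weight_ne_zero_iff π s).1 hr)).2,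
        natExt_coe, natExt_coe]
      ring
  have hW := Q.sum_weight_pos πb
  have hW' := Q.sum_weight_pos π
  constructor
  · have h1 : 0 ≤ ∑ s : Fin (S + 1), Q.weight π s * h s :=
      nonneg_of_mul_nonneg_right hcheb.1 hW
    have h2 : natExt h' 0 - natExt h 0 ≤ 0 := by
      by_contra! hlt
      have := mul_pos hW' hlt
      linarith
    intro s
    have := hle0 s (by omega)
    rw [natExt_coe, natExt_coe] at this
    linarith
  · rintro rfl
    have hw : ∀ s ≤ S, Q.weight π s = Q.weight πb s := by
      intro s hsS
      rcases Nat.eq_zero_or_pos s with rfl | h0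
      · rw [weight_zero, weight_zero]
      · have := hcheb.2 (by rw [hs', mul_zero]) ⟨s, by omega⟩ 0 h0
        simpa [weight_zero] using this
    -- With equal gains and equal biases the two equations agree in every state, so the inclusion
    -- also holds in states that `π` does not reach.
    have hsub : ∀ s (hs : s < S), π ⟨s, hs⟩ ⊆ πb ⟨s, hs⟩ := by
      intro s hsS
      refine (Q.greedy_le ((Q.isPIStep_iff H).1 hfix) π hsS).2 ?_
      cases s with
      | zero => have h1 := H.poisson.zero; have h2 := H'.poisson.zero; linarith
      | succ s =>
        have h1 := H.poisson.succ s (by omega)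
        have h2 := H'.poisson.succ s (by omega)
        linarith
    funext ⟨s, hsS⟩
    refine (hsub s hsS).antisymm fun i hi => ?_
    -- A class admitted in `s` is admitted in all lower states, so `s` is reached under `πb`; equal
    -- weights then yield equal birth rates.
    have hr : Q.weight πb s ≠ 0 := by
      rw [weight_ne_zero_iff]
      intro j hj
      rw [Q.natExt_birthRate πb (hj.trans hsS)]
      exact Finset.sum_pos (fun i _ => Q.arrivalRate_pos i)
        ⟨i, hfix.mem_of_le Q hpos hj.le hsS hi⟩
    have heq : natExt (Q.birthRate π) s = natExt (Q.birthRate πb) s := by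
      have h1 := hw (s + 1) hsS
      rw [weight_succ, weight_succ, hw s hsS.le] at h1
      exact (div_left_inj' (Q.deathRate_pos s).ne').1 (mul_left_cancel₀ hr h1)
    by_contra hi'
    have : natExt (Q.birthRate π) s < natExt (Q.birthRate πb) s := by
      rw [Q.natExt_birthRate π hsS, Q.natExt_birthRate πb hsS]
      exact Finset.sum_lt_sum_of_subset (hsub s hsS) hi hi' (Q.arrivalRate_pos i)
        fun j _ _ => (Q.arrivalRate_pos j).le
    exact this.ne heq

/-- A gain optimal trunk-reservation policy has smaller control levels than the limit of policy
iteration. -/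
theorem IsPIStep.level_le (hfix : Q.IsPIStep πb πb) (H : Q.SolvesEvaluation πb ρ h)
    (H' : Q.SolvesEvaluation π ρ h') {M M' : Fin m → ℕ} (hM : IsTrunkReservation πb M)
    (hM' : IsTrunkReservation π M') (i : Fin m) : M' i ≤ M i := by
  rcases Nat.eq_zero_or_pos (M' i) with h0 | h0
  · rw [h0]; exact Nat.zero_le _
  have hle := hM'.1 i
  -- This is the last state admitting class `i` under `π`. Class `i` alone makes it reachable, since
  -- it is admitted in all lower states.
  have hs : M' i - 1 < S := by omega
  have hr : Q.weight π (M' i - 1) ≠ 0 := by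
    rw [weight_ne_zero_iff]
    intro j hj
    rw [Q.natExt_birthRate π (hj.trans hs)]
    exact Finset.sum_pos (fun i _ => Q.arrivalRate_pos i)
      ⟨i, (hM'.2 _ i).2 (by simp only; omega)⟩
  have := hfix.subset_of_reachable H H' hs hr ((hM'.2 ⟨_, hs⟩ i).2 (by simp only; omega))
  have := (hM.2 _ i).1 this
  simp only at this
  omega

end

end AdmissionQueue

theorem mainTheorem6 {m c S : ℕ} (Q : AdmissionQueue m c S)
    (hpos : ∃ i, 0 < Q.netReward i 0) :
    ∃ πb : AdmissionPolicy m S,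
      Q.IsBiasOptimal πb ∧
      (∀ π : AdmissionPolicy m S, Q.IsBiasOptimal π → π = πb) ∧
      (∀ π₀ : AdmissionPolicy m S, ∃ π : ℕ → AdmissionPolicy m S, π 0 = π₀ ∧ Q.IsPIRun π) ∧
      (∀ π : ℕ → AdmissionPolicy m S, Q.IsPIRun π → ∃ L, ∀ l, L ≤ l → π l = πb) ∧
      ∃ M : Fin m → ℕ, IsTrunkReservation πb M ∧
        ∀ (π : AdmissionPolicy m S) (M' : Fin m → ℕ),
          Q.IsGainOptimal π → IsTrunkReservation π M' → ∀ i, M' i ≤ M i := by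
  obtain ⟨πb, hfix⟩ := Q.exists_isPIStep_self
  obtain ⟨h, hb⟩ := Q.exists_isBias πb
  obtain ⟨ρ, h₀, H₀⟩ := Q.exists_solvesEvaluation πb
  obtain ⟨H, hs⟩ := (Q.isBias_iff H₀).1 hb
  have hgo : Q.IsGainOptimal πb := (Q.isGainOptimal_iff hfix H H).2 rfl
  have hsolve : ∀ π, Q.IsGainOptimal π → ∃ h', Q.IsBias π h' ∧ Q.SolvesEvaluation π ρ h' ∧
      (∀ s, h' s ≤ h s) ∧ (h' = h → π = πb) := by
    intro π hπ
    obtain ⟨ρ', h₁, H₁⟩ := Q.exists_solvesEvaluation π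
    obtain rfl := (Q.isGainOptimal_iff hfix H H₁).1 hπ
    obtain ⟨h', hb'⟩ := Q.exists_isBias π
    obtain ⟨H', hs'⟩ := (Q.isBias_iff H₁).1 hb'
    exact ⟨h', hb', H', hfix.bias_le hpos H hs H' hs'⟩
  refine ⟨πb, ⟨hgo, h, hb, fun π hπ => ?_⟩, ?_, Q.exists_isPIRun, ?_, ?_⟩
  · obtain ⟨h', hb', -, hle, -⟩ := hsolve π hπ
    exact ⟨h', hb', hle⟩
  · rintro π ⟨hπ, h₁, hb₁, hopt⟩
    obtain ⟨h', hb', -, hle, huniq⟩ := hsolve π hπ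
    obtain ⟨h₂, hb₂, hle₂⟩ := hopt πb hgo
    rw [hb₂.unique Q hb, hb₁.unique Q hb'] at hle₂
    exact huniq (funext fun s => le_antisymm (hle s) (hle₂ s))
  · intro π hrun
    obtain ⟨L, hL⟩ := hrun.eventually_fixed
    exact ⟨L, fun l hl => (hL l hl).fixed_unique Q hfix⟩
  · obtain ⟨M, hM⟩ := hfix.exists_isTrunkReservation Q hpos
    refine ⟨M, hM, fun π M' hπ hM' => ?_⟩
    obtain ⟨h', -, H', -⟩ := hsolve π hπ
    exact hfix.level_le H H' hM hM'
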